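/- Let $G=(V,E)$ be a finite acyclic directed graph with a source $S$ and two distinct sinks $R_1,R_2$. The min-cut between $S$ and $R_i$ is the least number of edges whose removal destroys all directed paths from $S$ to $R_i$. A set of Menger's paths from $S$ to $R_i$ is a set of pairwise edge-disjoint directed paths from $S$ to $R_i$ of maximum cardinality. Two paths $\beta,\gamma$ merge at an edge $e$ if $e$ lies on both paths and the edges immediately preceding $e$ on $\beta$ and on $\gamma$ both exist and are distinct. For sets of Menger's paths $\alpha_1$ (from $S$ to $R_1$) and $\alpha_2$ (from $S$ to $R_2$), let $|G|_{\mathcal M}(\alpha_1,\alpha_2)$ be the number of edges at which some path of $\alpha_1$ merges with some path of $\alpha_2$, and let $M^*(G)$ be the minimum of $|G|_{\mathcal M}(\alpha_1,\alpha_2)$ over all choices of sets of Menger's paths $\alpha_1,\alpha_2$. Let $\mathcal M^*(c_1,c_2)$ be the supremum of $M^*(G)$ over all such $G$ (with their $S$, $R_1$, $R_2$) for which the min-cut between $S$ and $R_i$ equals $c_i$ for $i=1,2$. **Theorem.** $\mathcal M^*(4,4)=9.$ -/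

import Mathlib

/-- A directed graph with vertex set `V` and edge set `E`: the edge `e` goes from `src e` to
`tgt e`. Parallel edges are allowed. -/
structure Network (V E : Type) where
  src : E → V
  tgt : E → V

namespace Network

/-- `G.IsPath u v p`: the list `p` of concatenated edges is a directed path from `u` to `v`. -/
def IsPath {V E : Type} (G : Network V E) : V → V → List E → Prop
  | u, v, [] => u = v
  | u, v, e :: p => G.src e = u ∧ G.IsPath (G.tgt e) v p

/-- There is no directed cycle. -/
def Acyclic {V E : Type} (G : Network V E) : Prop :=
  ∀ (v : V) (p : List E), G.IsPath v v p → p = []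

/-- `C` meets every directed path from `u` to `v`. -/
def IsCut {V E : Type} (G : Network V E) (u v : V) (C : Set E) : Prop :=
  ∀ p : List E, G.IsPath u v p → ∃ e ∈ p, e ∈ C

/-- The min-cut between `u` and `v`: the least number of edges in a cut
(it is `⊤` when `u = v`, since there is no cut then). -/
noncomputable def minCut {V E : Type} (G : Network V E) (u v : V) : ℕ∞ :=
  ⨅ C ∈ {C : Set E | G.IsCut u v C}, C.encard

/-- A finite set of pairwise edge-disjoint directed paths from `u` to `v`. -/
def IsDisjointPathSet {V E : Type} (G : Network V E) (u v : V) (A : Finset (List E)) : Prop :=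
  (∀ p ∈ A, G.IsPath u v p) ∧ ∀ p ∈ A, ∀ q ∈ A, p ≠ q → List.Disjoint p q

/-- A set of Menger's paths from `u` to `v`: a set of pairwise edge-disjoint directed paths
from `u` to `v` with the maximum number of elements. -/
def IsMengerSet {V E : Type} (G : Network V E) (u v : V) (A : Finset (List E)) : Prop :=
  G.IsDisjointPathSet u v A ∧
    ∀ B : Finset (List E), G.IsDisjointPathSet u v B → B.card ≤ A.card

end Network

/-- The paths `β` and `γ` merge at the edge `e`: `e` lies on both, and the edges `f`, `g` that are
immediately ahead of `e` on `β` and on `γ`, respectively, exist and are distinct. -/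
def MergeAt {E : Type} (β γ : List E) (e : E) : Prop :=
  ∃ f g : E, f ≠ g ∧ [f, e] <:+: β ∧ [g, e] <:+: γ

/-- The edges at which paths from different groups merge. Mergings are counted without
multiplicity, one for each such edge; more than two paths that merge at `e` include two that
merge at `e`, so that it suffices to look at pairs of paths. -/
def mergingEdges {E ι : Type} (α : ι → Finset (List E)) : Set E :=
  {e | ∃ i j : ι, i ≠ j ∧ ∃ β ∈ α i, ∃ γ ∈ α j, MergeAt β γ e}

/-- The minimum number of mergings over all choices of sets of Menger's paths `α i` from the
common source `S` to the sinks `R i`. -/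
noncomputable def Network.minMergings {V E ι : Type} (G : Network V E) (S : V) (R : ι → V) : ℕ∞ :=
  ⨅ α ∈ {α : ι → Finset (List E) | ∀ i, G.IsMengerSet S (R i) (α i)}, (mergingEdges α).encard

/-- `𝓜*(c₁, …, c_l)`: the supremum of the minimum number of mergings over all finite acyclic
directed graphs with one source `S` and `l` distinct sinks `R i` such that the min-cut between `S`
and `R i` is `c i`. -/
noncomputable def MStar {l : ℕ} (c : Fin l → ℕ) : ℕ∞ :=
  sSup {m : ℕ∞ | ∃ (V E : Type) (_ : Finite V) (_ : Finite E) (G : Network V E)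
    (S : V) (R : Fin l → V), G.Acyclic ∧ Function.Injective R ∧
    (∀ i, G.minCut S (R i) = (c i : ℕ∞)) ∧ m = G.minMergings S R}

/-!
Let `φ` be a set of Menger's paths to the first sink and `ψ` one to the second, chosen such that
they take together as few steps from edge to edge as possible. A cycle in the residual graph of one
of them, restricted to the steps of both, would permit rerouting along steps of the other, and the
total would drop (`exists_usedSteps_ssubset`). So both residual relations (`Detour`) are acyclic.
Path sets are encoded as permutations of the edges and four tokens (`Network.IsRouting`), which
makes rerouting the composition with a permutation.

Now pass through the edges in a topological order and keep track of the last edges `x i` and `y j`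
passed on the paths of `φ` and of `ψ`. Let `A i j` say that `x i` leads to `y j` in the residual
relation of `φ`, and `B j i` that `y j` leads to `x i` in that of `ψ`. Where path `i` of `φ` merges
with path `j` of `ψ`, the step from `y j` becomes a detour to `x i` and vice versa, so acyclicity
forbids `A i j` and `B j i`; afterwards `A` and `B` are changed in a way that depends on `A`, `B`,
`i` and `j` only. Mergings are therefore the moves of a finite game on pairs of `4 × 4` matrices
that starts from two identity matrices (`GamePosition.canPlay_ncard`), and an exhaustive search
shows that this game ends after at most nine moves (`le_nine_of_canPlay`).

Conversely, a game of nine moves gives the network `nineNet`. It has potentials that increase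
exactly along the edges of the intended paths to one sink. Since the total increase of a potential
along four disjoint paths is determined by their ends, the edges used by a set of Menger's paths are
determined as well (`Network.IsDisjointPathSet.mem_iff_of_potential`), and each of the nine intended
mergings occurs.
-/

/-! ### A game on pairs of boolean matrices -/

/-- The effect of a move `(i, j)` on a relation `A` between rows and columns: everything related to
column `j` becomes related to what row `i` is related to, after which column `j` is emptied and
row `i` is related to it. -/
def moveStep (i j : Fin 4) (A : Fin 4 → Fin 4 → Bool) : Fin 4 → Fin 4 → Bool := fun a b =>
  if a = i then decide (b = j) || A i b
  else !decide (b = j) && (A a b || (A a j && A i b))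

/-- The relation at the start of the game: row `i` is related to column `i` only. -/
def diagRel : Fin 4 → Fin 4 → Bool := fun a b => decide (a = b)

/-- `canPlay k A B`: from the position `(A, B)` there is a sequence of `k` legal moves. A move
`(i, j)` is legal if `A i j` and `B j i` both fail; it changes `A` by `moveStep i j` and `B` by
`moveStep j i`. -/
def canPlay : ℕ → (Fin 4 → Fin 4 → Bool) → (Fin 4 → Fin 4 → Bool) → Bool
  | 0, _, _ => true
  | k + 1, A, B => (List.finRange 4).any fun i => (List.finRange 4).any fun j =>
      !A i j && (!B j i && canPlay k (moveStep i j A) (moveStep j i B))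

theorem canPlay_succ {k : ℕ} {A B : Fin 4 → Fin 4 → Bool} :
    canPlay (k + 1) A B = true ↔ ∃ i j, A i j = false ∧ B j i = false ∧
      canPlay k (moveStep i j A) (moveStep j i B) = true := by
  simp [canPlay]

theorem canPlay_of_succ : ∀ {k : ℕ} {A B : Fin 4 → Fin 4 → Bool},
    canPlay (k + 1) A B = true → canPlay k A B = true
  | 0, _, _, _ => rfl
  | _ + 1, _, _, h => by
    obtain ⟨i, j, hA, hB, h⟩ := canPlay_succ.1 h
    exact canPlay_succ.2 ⟨i, j, hA, hB, canPlay_of_succ h⟩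

theorem canPlay_mono {k l : ℕ} (hkl : k ≤ l) {A B : Fin 4 → Fin 4 → Bool}
    (h : canPlay l A B = true) : canPlay k A B = true := by
  induction l, hkl using Nat.le_induction with
  | base => exact h
  | succ l _ ih => exact ih (canPlay_of_succ h)

theorem moveStep_relabel (π : Equiv.Perm (Fin 4)) (i j : Fin 4) (A : Fin 4 → Fin 4 → Bool) :
    moveStep i j (fun a b => A (π a) (π b)) =
      fun a b => moveStep (π i) (π j) A (π a) (π b) := by
  funext a b
  simp [moveStep]

theorem canPlay_relabel (π : Equiv.Perm (Fin 4)) : ∀ {k : ℕ} {A B : Fin 4 → Fin 4 → Bool},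
    canPlay k A B = true → canPlay k (fun a b => A (π a) (π b)) (fun a b => B (π a) (π b)) = true
  | 0, _, _, _ => rfl
  | k + 1, A, B, h => by
    obtain ⟨i, j, hA, hB, h⟩ := canPlay_succ.1 h
    refine canPlay_succ.2 ⟨π.symm i, π.symm j, by simpa using hA, by simpa using hB, ?_⟩
    rw [moveStep_relabel, moveStep_relabel]
    simpa using canPlay_relabel π h

set_option maxRecDepth 100000 in
/-- After the first move, the positions that can arise are searched exhaustively; there are about
six thousand sequences of legal moves. -/
theorem canPlay_nine_after_move :
    canPlay 9 (moveStep 0 1 diagRel) (moveStep 1 0 diagRel) = false := by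
  decide +kernel

/-- A game that starts from the diagonal has at most nine moves. Relabelling rows and columns
simultaneously fixes the starting position, so that the first move may be taken to be `(0, 1)`. -/
theorem le_nine_of_canPlay {k : ℕ} (h : canPlay k diagRel diagRel = true) : k ≤ 9 := by
  by_contra! hk
  obtain ⟨i, j, hij, -, h⟩ := canPlay_succ.1 (canPlay_mono (k := 9 + 1) hk h)
  have hne : i ≠ j := by simpa [diagRel] using hij
  obtain ⟨π, rfl, rfl⟩ : ∃ π : Equiv.Perm (Fin 4), π 0 = i ∧ π 1 = j := by
    clear hij h
    revert i j
    decide +kernel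
  have hd : (fun a b => diagRel (π a) (π b)) = diagRel := by
    funext a b
    simp [diagRel]
  have := canPlay_relabel π h
  rw [← moveStep_relabel, ← moveStep_relabel, hd, canPlay_nine_after_move] at this
  exact Bool.false_ne_true this

/-! ### Routings and their exchange -/

/-- Up to four edge-disjoint paths from `S` to `R`, encoded as a permutation of the edges together
with four tokens: a token goes to the first edge of its path, an edge on a path goes to the next
one, and the last edge goes to some token. Edges off the paths are fixed, and tokens that go to
tokens are not in use. -/
structure Network.IsRouting {V E : Type} (G : Network V E) (S R : V)
    (φ : Equiv.Perm (E ⊕ Fin 4)) : Prop where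
  adj : ∀ e f, φ (.inl e) = .inl f → e = f ∨ G.tgt e = G.src f
  start : ∀ i f, φ (.inr i) = .inl f → G.src f = S
  finish : ∀ e i, φ (.inl e) = .inr i → G.tgt e = R

/-- The steps into an edge that at least one of two routings makes. -/
def usedSteps {E : Type} (φ ψ : Equiv.Perm (E ⊕ Fin 4)) : Set ((E ⊕ Fin 4) × E) :=
  {t | t.1 ≠ .inl t.2 ∧ (φ t.1 = .inl t.2 ∨ ψ t.1 = .inl t.2)}

theorem usedSteps_comm {E : Type} (φ ψ : Equiv.Perm (E ⊕ Fin 4)) :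
    usedSteps φ ψ = usedSteps ψ φ := by
  ext t
  simp [usedSteps, or_comm]

/-- The residual relation of the routing `φ` relative to `ψ`: `a` may go, in place of `φ a`, to the
edge `e = φ b`, either because `ψ` does so or because `a = e` is then left unused. -/
def Detour {E : Type} (φ ψ : Equiv.Perm (E ⊕ Fin 4)) (a b : E ⊕ Fin 4) : Prop :=
  a ≠ b ∧ ∃ e : E, φ b = .inl e ∧ (a = .inl e ∨ ψ a = .inl e)

/-- A nonempty subset of a finite type in which every element has a successor contains a nonempty
subset on which a choice of successors is a permutation. -/
theorem exists_perm_of_forall_exists {α : Type} [Finite α] {r : α → α → Prop} {Z : Set α}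
    (hZ : Z.Nonempty) (h : ∀ a ∈ Z, ∃ b ∈ Z, r a b) :
    ∃ (Y : Set α) (σ : Equiv.Perm α), Y.Nonempty ∧ (∀ a ∈ Y, σ a ∈ Y ∧ r a (σ a)) ∧
      ∀ a ∉ Y, σ a = a := by
  classical
  obtain ⟨Y, -, hY⟩ := (Set.toFinite
    {Z : Set α | Z.Nonempty ∧ ∀ a ∈ Z, ∃ b ∈ Z, r a b}).exists_le_minimal (a := Z) ⟨hZ, h⟩
  obtain ⟨⟨hne, hs⟩, hmin⟩ := hY
  choose! s hsY hsr using hs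
  have himg : s '' Y ⊆ Y := by
    rintro _ ⟨a, ha, rfl⟩
    exact hsY a ha
  have hsub : Y ⊆ s '' Y := hmin (y := s '' Y) ⟨hne.image s, by
    rintro _ ⟨a, ha, rfl⟩
    exact ⟨s (s a), ⟨s a, hsY a ha, rfl⟩, hsr _ (hsY a ha)⟩⟩ himg
  let g : α → α := fun a => if a ∈ Y then s a else a
  have hg : Function.Surjective g := by
    intro b
    by_cases hb : b ∈ Y
    · obtain ⟨a, ha, rfl⟩ := hsub hb
      exact ⟨a, by simp [g, ha]⟩
    · exact ⟨b, by simp [g, hb]⟩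
  refine ⟨Y, Equiv.ofBijective g (Finite.injective_iff_bijective.1
    (Finite.injective_iff_surjective.2 hg)), hne, ?_, ?_⟩
  · intro a ha
    simp only [Equiv.ofBijective_apply, g, if_pos ha]
    exact ⟨hsY a ha, hsr a ha⟩
  · intro a ha
    simp [g, if_neg ha]

/-- Exchange along a cycle of detours. The new routing makes only steps of `φ` and `ψ`, starts the
same paths, and drops a step: otherwise the cycle would run along `ψ` alone, against the ranking of
the edges. -/
theorem exists_usedSteps_ssubset {V E : Type} [Finite E] {G : Network V E} {S R R' : V}
    {r : E → ℕ} (hr : ∀ e f, G.tgt e = G.src f → r e < r f)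
    {φ ψ : Equiv.Perm (E ⊕ Fin 4)} (hφ : G.IsRouting S R φ) (hψ : G.IsRouting S R' ψ)
    {a : E ⊕ Fin 4} (ha : Relation.TransGen (Detour φ ψ) a a) :
    ∃ φ', G.IsRouting S R φ' ∧ (∀ i, (φ (.inr i)).isLeft → (φ' (.inr i)).isLeft) ∧
      usedSteps φ' ψ ⊂ usedSteps φ ψ := by
  obtain ⟨Y, σ, ⟨y, hy⟩, hσ, hfix⟩ := exists_perm_of_forall_exists (r := Detour φ ψ)
    (Z := {b | Relation.TransGen (Detour φ ψ) b a}) ⟨a, ha⟩ (by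
      intro b hb
      obtain ⟨c, hbc, hca⟩ := Relation.TransGen.head'_iff.1 hb
      rcases Relation.reflTransGen_iff_eq_or_transGen.1 hca with rfl | hca
      · exact ⟨a, ha, hbc⟩
      · exact ⟨c, hca, hbc⟩)
  -- every element of `Y` is the successor of an element of `Y`
  have hsurj : ∀ b ∈ Y, ∃ c ∈ Y, σ c = b := by
    intro b hb
    refine ⟨σ.symm b, ?_, σ.apply_symm_apply b⟩
    by_contra hc
    have := hfix _ hc
    rw [σ.apply_symm_apply] at this
    exact hc (this ▸ hb)
  have hin : ∀ b ∈ Y, ∃ e, φ (σ b) = .inl e ∧ (b = .inl e ∨ ψ b = .inl e) :=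
    fun b hb => (hσ b hb).2.2
  have hne : ∀ b ∈ Y, φ (σ b) ≠ φ b := fun b hb h => (hσ b hb).2.1 (φ.injective h).symm
  have hsub : usedSteps (φ * σ) ψ ⊆ usedSteps φ ψ := by
    rintro ⟨b, e⟩ ⟨hbe, h⟩
    refine ⟨hbe, ?_⟩
    rcases h with h | h
    · by_cases hb : b ∈ Y
      · obtain ⟨e', he', h'⟩ := hin b hb
        have : e' = e := by simpa [he'] using h
        subst this
        exact .inr (h'.resolve_left hbe)
      · left
        simpa [hfix b hb] using h
    · exact .inr h
  refine ⟨φ * σ, ⟨?_, ?_, ?_⟩, ?_, hsub, ?_⟩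
  · intro e f h
    rw [Equiv.Perm.mul_apply] at h
    by_cases hb : .inl e ∈ Y
    · obtain ⟨e', he', h'⟩ := hin _ hb
      obtain rfl : e' = f := by simpa [he'] using h
      rcases h' with h' | h'
      · exact .inl (Sum.inl.inj h')
      · exact hψ.adj _ _ h'
    · rw [hfix _ hb] at h
      exact hφ.adj _ _ h
  · intro i f h
    rw [Equiv.Perm.mul_apply] at h
    by_cases hb : .inr i ∈ Y
    · obtain ⟨e', he', h'⟩ := hin _ hb
      obtain rfl : e' = f := by simpa [he'] using h
      exact hψ.start _ _ (h'.resolve_left (by simp))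
    · rw [hfix _ hb] at h
      exact hφ.start _ _ h
  · intro e i h
    rw [Equiv.Perm.mul_apply] at h
    by_cases hb : .inl e ∈ Y
    · obtain ⟨e', he', -⟩ := hin _ hb
      simp [he'] at h
    · rw [hfix _ hb] at h
      exact hφ.finish _ _ h
  · intro i h
    rw [Equiv.Perm.mul_apply]
    by_cases hb : .inr i ∈ Y
    · obtain ⟨e', he', -⟩ := hin _ hb
      simp [he']
    · rwa [hfix _ hb]
  · intro hsup
    -- no step of `φ` at `Y` is dropped, so that each is a step of `ψ` or no step at all
    have key : ∀ b ∈ Y, ∃ e, φ b = .inl e ∧ (b = .inl e ∨ ψ b = .inl e) := by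
      intro b hb
      obtain ⟨c, hc, rfl⟩ := hsurj b hb
      obtain ⟨e, he, -⟩ := hin c hc
      refine ⟨e, he, ?_⟩
      by_contra! hcon
      rcases (hsup (a := (σ c, e)) ⟨hcon.1, .inl he⟩).2 with h | h
      · exact hne _ hb (by simpa [he] using h)
      · exact hcon.2 h
    have hlt : ∀ e f, e ≠ f → ψ (.inl e) = .inl f → r e < r f := fun e f hef h =>
      hr _ _ ((hψ.adj _ _ h).resolve_left hef)
    have hedge : ∀ b ∈ Y, ∃ e, b = .inl e := by
      intro b hb
      obtain ⟨e, he, h | h⟩ := key b hb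
      · exact ⟨e, h⟩
      · obtain ⟨f, hf, h' | h'⟩ := hin b hb
        · exact ⟨f, h'⟩
        · exact absurd (hf.trans (h'.symm.trans (h.trans he.symm))) (hne b hb)
    -- where `φ` follows `ψ`, the detours run along `ψ` backwards
    have hback : ∀ e f, .inl e ∈ Y → φ (.inl e) = .inl f → e ≠ f →
        ∃ e', .inl e' ∈ Y ∧ φ (.inl e') = .inl e ∧ e' ≠ e ∧ r e' < r e := by
      intro e f he hef hne'
      obtain ⟨f', hf', h⟩ := key _ he
      obtain rfl : f = f' := by simpa [hef] using hf'
      have h := h.resolve_left (fun h => hne' (Sum.inl.inj h))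
      obtain ⟨e', he'⟩ := hedge _ (hσ _ he).1
      obtain ⟨g, hg, h'⟩ := hin _ he
      rcases h' with h' | h'
      · obtain rfl := Sum.inl.inj h'
        obtain ⟨g', hg', h''⟩ := key _ (hσ _ he).1
        obtain rfl : e = g' := by simpa [hg] using hg'
        have hee' : e' ≠ e := fun hh => (hσ _ he).2.1 (by rw [he', hh])
        rw [he'] at h'' hg
        have h'' := h''.resolve_left (fun h => hee' (Sum.inl.inj h))
        exact ⟨e', he' ▸ (hσ _ he).1, hg, hee', hlt _ _ hee' h''⟩
      · exact absurd (hg.trans (h'.symm.trans (h.trans hf'.symm))) (hne _ he)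
    have hnot : ∀ n e f, r e = n → .inl e ∈ Y → φ (.inl e) = .inl f → e ≠ f → False := by
      intro n
      induction n using Nat.strong_induction_on with
      | _ n ih =>
        intro e f hn he hef hne'
        obtain ⟨e', he', h1, h2, h3⟩ := hback e f he hef hne'
        exact ih _ (hn ▸ h3) e' e rfl he' h1 h2
    -- hence `φ` fixes `Y`, and the detours run along `ψ` forwards
    have hfwd : ∀ e, .inl e ∈ Y → ∃ f, .inl f ∈ Y ∧ r e < r f := by
      intro e he
      obtain ⟨f, hf⟩ := hedge _ (hσ _ he).1
      have hY := (hσ _ he).1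
      obtain ⟨g, hg, h⟩ := hin _ he
      rw [hf] at hg hY
      have hfg : f = g := by
        by_contra hh
        exact hnot _ f g rfl hY hg hh
      subst hfg
      have hef : e ≠ f := fun hh => (hσ _ he).2.1 (by rw [hf, hh])
      exact ⟨f, hY, hlt _ _ hef (h.resolve_left (fun hh => hef (Sum.inl.inj hh)))⟩
    obtain ⟨e, rfl⟩ := hedge y hy
    obtain ⟨m, hm, hmax⟩ :=
      (Set.toFinite {e : E | (.inl e : E ⊕ Fin 4) ∈ Y}).exists_maximalFor r _ ⟨e, hy⟩
    obtain ⟨f, hf, hlt'⟩ := hfwd m hm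
    exact absurd (hmax hf hlt'.le) (not_le.2 hlt')

/-! ### Mergings as moves of the game -/

/-- The position of the game after the edges in `D` have been passed. The elements `x i` and `y j`
are the last ones passed on the path of `φ` from token `i` and on the path of `ψ` from token `j`.
The matrices record detours between them; while `x i = y j`, nothing else is recorded to lead to
the column `j` of `A` or to the row `i` of `B`, so that both paths may move on along a common
edge. -/
structure GamePosition {E : Type} (φ ψ : Equiv.Perm (E ⊕ Fin 4)) (D : Set E)
    (x y : Fin 4 → E ⊕ Fin 4) (A B : Fin 4 → Fin 4 → Bool) : Prop where
  mem_left : ∀ i e, x i = .inl e → e ∈ D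
  mem_right : ∀ j e, y j = .inl e → e ∈ D
  front_left : ∀ e ∉ D, ∀ a, φ a = .inl e → (∀ f, a = .inl f → f ∈ D) → ∃ i, x i = a
  front_right : ∀ e ∉ D, ∀ a, ψ a = .inl e → (∀ f, a = .inl f → f ∈ D) → ∃ j, y j = a
  detour_left : ∀ i j, A i j = true → Relation.ReflTransGen (Detour φ ψ) (x i) (y j)
  detour_right : ∀ i j, B j i = true → Relation.ReflTransGen (Detour ψ φ) (y j) (x i)
  joint_left : ∀ i j, x i = y j → ∀ a, A a j = true → a = i
  joint_right : ∀ i j, x i = y j → ∀ b, B b i = true → b = j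

namespace GamePosition

variable {E : Type} {φ ψ : Equiv.Perm (E ⊕ Fin 4)} {D : Set E} {x y : Fin 4 → E ⊕ Fin 4}
  {A B : Fin 4 → Fin 4 → Bool}

theorem symm (h : GamePosition φ ψ D x y A B) : GamePosition ψ φ D y x B A where
  mem_left := h.mem_right
  mem_right := h.mem_left
  front_left := h.front_right
  front_right := h.front_left
  detour_left i j := h.detour_right j i
  detour_right i j := h.detour_left j i
  joint_left i j hij := h.joint_right j i hij.symm
  joint_right i j hij := h.joint_left j i hij.symm

theorem init : GamePosition φ ψ ∅ .inr .inr diagRel diagRel where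
  mem_left i e h := by simp at h
  mem_right i e h := by simp at h
  front_left e _ a _ h := by
    rcases a with a | i
    · exact absurd (h a rfl) (by simp)
    · exact ⟨i, rfl⟩
  front_right e _ a _ h := by
    rcases a with a | i
    · exact absurd (h a rfl) (by simp)
    · exact ⟨i, rfl⟩
  detour_left i j h := by
    obtain rfl : i = j := by simpa [diagRel] using h
    exact .refl
  detour_right i j h := by
    obtain rfl : j = i := by simpa [diagRel] using h
    exact .refl
  joint_left i j h a ha := by
    obtain rfl : i = j := by simpa using h
    simpa [diagRel] using ha
  joint_right i j h a ha := by
    obtain rfl : i = j := by simpa using h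
    simpa [diagRel] using ha

theorem front_insert_of_fixed (h : GamePosition φ ψ D x y A B) {e : E} (he : φ (.inl e) = .inl e) :
    ∀ e' ∉ insert e D, ∀ a, φ a = .inl e' → (∀ f, a = .inl f → f ∈ insert e D) →
      ∃ i, x i = a := by
  intro e' he' a ha hD
  rw [Set.mem_insert_iff, not_or] at he'
  refine h.front_left e' he'.2 a ha fun f hf => (Set.mem_insert_iff.1 (hD f hf)).resolve_left ?_
  rintro rfl
  subst hf
  exact he'.1 (Sum.inl.inj (ha.symm.trans he))

theorem front_insert_of_step (h : GamePosition φ ψ D x y A B) {e : E} {i : Fin 4}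
    (hi : φ (x i) = .inl e) :
    ∀ e' ∉ insert e D, ∀ a, φ a = .inl e' → (∀ f, a = .inl f → f ∈ insert e D) →
      ∃ k, Function.update x i (.inl e) k = a := by
  intro e' he' a ha hD
  by_cases hae : a = .inl e
  · exact ⟨i, by simp [hae]⟩
  rw [Set.mem_insert_iff, not_or] at he'
  obtain ⟨k, hk⟩ := h.front_left e' he'.2 a ha fun f hf =>
    (Set.mem_insert_iff.1 (hD f hf)).resolve_left (by rintro rfl; exact hae hf)
  refine ⟨k, ?_⟩
  rw [Function.update_of_ne, hk]
  rintro rfl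
  rw [hk, ha] at hi
  exact he'.1 (Sum.inl.inj hi)

theorem mem_insert_of_update (h : GamePosition φ ψ D x y A B) (e : E) (i : Fin 4) :
    ∀ k f, Function.update x i (.inl e) k = .inl f → f ∈ insert e D := by
  intro k f hk
  by_cases hki : k = i
  · subst hki
    left
    simpa using hk.symm
  · rw [Function.update_of_ne hki] at hk
    exact .inr (h.mem_left k f hk)

/-- Passing an edge that is on no path. -/
theorem skip (h : GamePosition φ ψ D x y A B) {e : E} (hφ : φ (.inl e) = .inl e)
    (hψ : ψ (.inl e) = .inl e) : GamePosition φ ψ (insert e D) x y A B where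
  mem_left i f hf := .inr (h.mem_left i f hf)
  mem_right i f hf := .inr (h.mem_right i f hf)
  front_left := h.front_insert_of_fixed hφ
  front_right := h.symm.front_insert_of_fixed hψ
  detour_left := h.detour_left
  detour_right := h.detour_right
  joint_left := h.joint_left
  joint_right := h.joint_right

/-- Passing an edge that is on a path of `φ` only. -/
theorem advance (h : GamePosition φ ψ D x y A B) {e : E} (he : e ∉ D) {i : Fin 4}
    (hi : φ (x i) = .inl e) (hψ : ψ (.inl e) = .inl e) :
    GamePosition φ ψ (insert e D) (Function.update x i (.inl e)) y A B := by
  have hxe : ∀ k, x k ≠ .inl e := fun k hk => he (h.mem_left k e hk)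
  have hye : ∀ k, y k ≠ .inl e := fun k hk => he (h.mem_right k e hk)
  refine ⟨h.mem_insert_of_update e i, fun k f hf => .inr (h.mem_right k f hf),
    h.front_insert_of_step hi, h.symm.front_insert_of_fixed hψ, ?_, ?_, ?_, ?_⟩
  · intro k j hA
    by_cases hk : k = i
    · subst hk
      rw [Function.update_self]
      exact .head ⟨(hxe k).symm, e, hi, .inl rfl⟩ (h.detour_left k j hA)
    · rw [Function.update_of_ne hk]
      exact h.detour_left k j hA
  · intro k j hB
    by_cases hk : k = i
    · subst hk
      rw [Function.update_self]
      exact .tail (h.detour_right k j hB) ⟨hxe k, e, hψ, .inr hi⟩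
    · rw [Function.update_of_ne hk]
      exact h.detour_right k j hB
  · intro k j hkj
    by_cases hk : k = i
    · subst hk
      rw [Function.update_self] at hkj
      exact absurd hkj.symm (hye j)
    · rw [Function.update_of_ne hk] at hkj
      exact h.joint_left k j hkj
  · intro k j hkj
    by_cases hk : k = i
    · subst hk
      rw [Function.update_self] at hkj
      exact absurd hkj.symm (hye j)
    · rw [Function.update_of_ne hk] at hkj
      exact h.joint_right k j hkj

theorem detour_common (h : GamePosition φ ψ D x y A B) {e : E} (he : e ∉ D) {i j : Fin 4}
    (hij : x i = y j) (hi : φ (x i) = .inl e) (k l : Fin 4) (hA : A k l = true) :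
    Relation.ReflTransGen (Detour φ ψ) (Function.update x i (.inl e) k)
      (Function.update y j (.inl e) l) := by
  have hxe : ∀ k, x k ≠ .inl e := fun k hk => he (h.mem_left k e hk)
  by_cases hl : l = j
  · subst hl
    obtain rfl := h.joint_left i l hij k hA
    rw [Function.update_self, Function.update_self]
  · rw [Function.update_of_ne hl]
    by_cases hk : k = i
    · subst hk
      rw [Function.update_self]
      exact .head ⟨(hxe k).symm, e, hi, .inl rfl⟩ (h.detour_left k l hA)
    · rw [Function.update_of_ne hk]
      exact h.detour_left k l hA

theorem joint_common (h : GamePosition φ ψ D x y A B) {e : E} (he : e ∉ D) {i j : Fin 4}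
    (hij : x i = y j) (k l : Fin 4)
    (hkl : Function.update x i (.inl e) k = Function.update y j (.inl e) l) : x k = y l := by
  have hxe : ∀ k, x k ≠ .inl e := fun k hk => he (h.mem_left k e hk)
  have hye : ∀ k, y k ≠ .inl e := fun k hk => he (h.mem_right k e hk)
  by_cases hk : k = i <;> by_cases hl : l = j
  · subst hk hl
    exact hij
  · subst hk
    rw [Function.update_self, Function.update_of_ne hl] at hkl
    exact absurd hkl.symm (hye l)
  · subst hl
    rw [Function.update_self, Function.update_of_ne hk] at hkl
    exact absurd hkl (hxe k)
  · rwa [Function.update_of_ne hk, Function.update_of_ne hl] at hkl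

/-- Passing an edge to which a path of `φ` and a path of `ψ` come along the same edge. -/
theorem common (h : GamePosition φ ψ D x y A B) {e : E} (he : e ∉ D) {i j : Fin 4}
    (hij : x i = y j) (hi : φ (x i) = .inl e) (hj : ψ (y j) = .inl e) :
    GamePosition φ ψ (insert e D) (Function.update x i (.inl e)) (Function.update y j (.inl e))
      A B where
  mem_left := h.mem_insert_of_update e i
  mem_right := h.symm.mem_insert_of_update e j
  front_left := h.front_insert_of_step hi
  front_right := h.symm.front_insert_of_step hj
  detour_left := h.detour_common he hij hi
  detour_right k l := h.symm.detour_common he hij.symm hj l k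
  joint_left k l hkl := h.joint_left k l (h.joint_common he hij k l hkl)
  joint_right k l hkl := h.joint_right k l (h.joint_common he hij k l hkl)

/-- A merging is a legal move: if `A i j` held, the recorded detour from `x i` to `y j` and the
detour from `y j` to `x i` at the edge `e` would form a cycle. -/
theorem legal (h : GamePosition φ ψ D x y A B) (hac : ∀ a, ¬ Relation.TransGen (Detour φ ψ) a a)
    {e : E} {i j : Fin 4} (hij : x i ≠ y j) (hi : φ (x i) = .inl e) (hj : ψ (y j) = .inl e) :
    A i j = false := by
  rw [← Bool.not_eq_true]
  intro hA
  exact hac _ (.tail' (h.detour_left i j hA) ⟨hij.symm, e, hi, .inr hj⟩)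

theorem detour_move (h : GamePosition φ ψ D x y A B) {e : E} (he : e ∉ D) {i j : Fin 4}
    (hij : x i ≠ y j) (hi : φ (x i) = .inl e) (hj : ψ (y j) = .inl e) (k l : Fin 4)
    (hA : moveStep i j A k l = true) :
    Relation.ReflTransGen (Detour φ ψ) (Function.update x i (.inl e) k)
      (Function.update y j (.inl e) l) := by
  have hxe : ∀ k, x k ≠ .inl e := fun k hk => he (h.mem_left k e hk)
  by_cases hk : k = i
  · subst hk
    rw [Function.update_self]
    by_cases hl : l = j
    · subst hl
      rw [Function.update_self]
    · rw [Function.update_of_ne hl]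
      exact .head ⟨(hxe k).symm, e, hi, .inl rfl⟩
        (h.detour_left k l (by simpa [moveStep, hl] using hA))
  · have hA' : l ≠ j ∧ (A k l = true ∨ A k j = true ∧ A i l = true) := by
      simpa [moveStep, hk] using hA
    rw [Function.update_of_ne hk, Function.update_of_ne hA'.1]
    rcases hA'.2 with hA | ⟨h1, h2⟩
    · exact h.detour_left k l hA
    · exact (h.detour_left k j h1).trans (.head ⟨hij.symm, e, hi, .inr hj⟩ (h.detour_left i l h2))

theorem joint_move (h : GamePosition φ ψ D x y A B) {e : E} (he : e ∉ D) {i j : Fin 4}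
    (k l : Fin 4) (hkl : Function.update x i (.inl e) k = Function.update y j (.inl e) l) :
    ∀ a, moveStep i j A a l = true → a = k := by
  have hxe : ∀ k, x k ≠ .inl e := fun k hk => he (h.mem_left k e hk)
  have hye : ∀ k, y k ≠ .inl e := fun k hk => he (h.mem_right k e hk)
  intro a ha
  by_cases hk : k = i
  · subst hk
    by_cases hl : l = j
    · subst hl
      by_contra hak
      simp [moveStep, hak] at ha
    · rw [Function.update_self, Function.update_of_ne hl] at hkl
      exact absurd hkl.symm (hye l)
  · by_cases hl : l = j
    · subst hl
      rw [Function.update_self, Function.update_of_ne hk] at hkl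
      exact absurd hkl (hxe k)
    · rw [Function.update_of_ne hk, Function.update_of_ne hl] at hkl
      have hil : A i l = false := by
        rw [← Bool.not_eq_true]
        exact fun hA => hk (h.joint_left k l hkl i hA).symm
      by_cases hai : a = i
      · simp [moveStep, hai, hl, hil] at ha
      · exact h.joint_left k l hkl a (by simpa [moveStep, hai, hl, hil] using ha)

/-- Passing an edge at which a path of `φ` and a path of `ψ` merge. -/
theorem move (h : GamePosition φ ψ D x y A B) {e : E} (he : e ∉ D) {i j : Fin 4}
    (hij : x i ≠ y j) (hi : φ (x i) = .inl e) (hj : ψ (y j) = .inl e) :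
    GamePosition φ ψ (insert e D) (Function.update x i (.inl e)) (Function.update y j (.inl e))
      (moveStep i j A) (moveStep j i B) where
  mem_left := h.mem_insert_of_update e i
  mem_right := h.symm.mem_insert_of_update e j
  front_left := h.front_insert_of_step hi
  front_right := h.symm.front_insert_of_step hj
  detour_left := h.detour_move he hij hi hj
  detour_right k l := h.symm.detour_move he hij.symm hj hi l k
  joint_left := h.joint_move he
  joint_right k l hkl := h.symm.joint_move he l k hkl.symm

end GamePosition

/-- The edges at which two routings arrive, from different places. -/
def mergedEdges {E : Type} (φ ψ : Equiv.Perm (E ⊕ Fin 4)) : Set E :=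
  {e | ∃ a b, a ≠ b ∧ φ a = .inl e ∧ ψ b = .inl e ∧ a ≠ .inl e ∧ b ≠ .inl e}

/-- If both residual relations are acyclic, the mergings yet to be passed can be played as legal
moves. The edges are passed by increasing rank, so that the edges before the next one are among the
`x i` and `y j`. -/
theorem GamePosition.canPlay_ncard {E : Type} [Finite E] {φ ψ : Equiv.Perm (E ⊕ Fin 4)} {r : E → ℕ}
    (hφ : ∀ e f, e ≠ f → φ (.inl e) = .inl f → r e < r f)
    (hψ : ∀ e f, e ≠ f → ψ (.inl e) = .inl f → r e < r f)
    (h1 : ∀ a, ¬ Relation.TransGen (Detour φ ψ) a a)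
    (h2 : ∀ a, ¬ Relation.TransGen (Detour ψ φ) a a) :
    ∀ (n : ℕ) (D : Set E), Dᶜ.ncard = n → ∀ x y A B, GamePosition φ ψ D x y A B →
      canPlay (mergedEdges φ ψ \ D).ncard A B = true := by
  intro n
  induction n with
  | zero =>
    intro D hD x y A B _
    have : D = Set.univ := by
      rwa [Set.ncard_eq_zero, Set.compl_empty_iff] at hD
    simp [this, canPlay]
  | succ n ih =>
    intro D hD x y A B h
    obtain ⟨e, he, hmin⟩ := (Set.toFinite Dᶜ).exists_minimalFor r _
      (Set.nonempty_of_ncard_ne_zero (by omega))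
    have hmin : ∀ f, r f < r e → f ∈ D := fun f hf => by
      by_contra hfD
      exact absurd (hmin hfD hf.le) (not_le.2 hf)
    have hD' : (insert e D)ᶜ.ncard = n := by
      have : (insert e D)ᶜ = Dᶜ \ {e} := by
        ext f
        simp [not_or, and_comm]
      rw [this, Set.ncard_sdiff_singleton_of_mem he, hD]
      rfl
    have hrest : e ∉ mergedEdges φ ψ → mergedEdges φ ψ \ insert e D = mergedEdges φ ψ \ D := by
      intro hem
      ext f
      simp only [Set.mem_sdiff, Set.mem_insert_iff, not_or]
      refine ⟨fun hf => ⟨hf.1, hf.2.2⟩, fun hf => ⟨hf.1, ?_, hf.2⟩⟩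
      rintro rfl
      exact hem hf.1
    have hxi : ∀ a, φ a = .inl e → a ≠ .inl e → ∃ i, x i = a := fun a ha hae =>
      h.front_left e he a ha (by
        rintro f rfl
        exact hmin f (hφ f e (fun hh => hae (by rw [hh])) ha))
    have hyj : ∀ a, ψ a = .inl e → a ≠ .inl e → ∃ j, y j = a := fun a ha hae =>
      h.front_right e he a ha (by
        rintro f rfl
        exact hmin f (hψ f e (fun hh => hae (by rw [hh])) ha))
    have hxe : ∀ k, x k ≠ .inl e := fun k hk => he (h.mem_left k e hk)
    have hye : ∀ k, y k ≠ .inl e := fun k hk => he (h.mem_right k e hk)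
    by_cases hφe : φ (.inl e) = .inl e
    · have hem : e ∉ mergedEdges φ ψ := by
        rintro ⟨a, b, -, ha, -, hae, -⟩
        exact hae (φ.injective (ha.trans hφe.symm))
      rw [← hrest hem]
      by_cases hψe : ψ (.inl e) = .inl e
      · exact ih _ hD' _ _ _ _ (h.skip hφe hψe)
      · obtain ⟨j, hj⟩ := hyj (ψ.symm (.inl e)) (by simp) (by
          rwa [ne_eq, Equiv.symm_apply_eq, eq_comm])
        exact ih _ hD' _ _ _ _ (h.symm.advance he (i := j) (by simp [hj]) hφe).symm
    · obtain ⟨i, hi⟩ := hxi (φ.symm (.inl e)) (by simp) (by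
          rwa [ne_eq, Equiv.symm_apply_eq, eq_comm])
      replace hi : φ (x i) = .inl e := by simp [hi]
      by_cases hψe : ψ (.inl e) = .inl e
      · have hem : e ∉ mergedEdges φ ψ := by
          rintro ⟨a, b, -, -, hb, -, hbe⟩
          exact hbe (ψ.injective (hb.trans hψe.symm))
        rw [← hrest hem]
        exact ih _ hD' _ _ _ _ (h.advance he hi hψe)
      obtain ⟨j, hj⟩ := hyj (ψ.symm (.inl e)) (by simp) (by
          rwa [ne_eq, Equiv.symm_apply_eq, eq_comm])
      replace hj : ψ (y j) = .inl e := by simp [hj]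
      by_cases hij : x i = y j
      · have hem : e ∉ mergedEdges φ ψ := by
          rintro ⟨a, b, hab, ha, hb, -, -⟩
          rw [← hi, φ.apply_eq_iff_eq] at ha
          rw [← hj, ψ.apply_eq_iff_eq] at hb
          exact hab (ha.trans (hij.trans hb.symm))
        rw [← hrest hem]
        exact ih _ hD' _ _ _ _ (h.common he hij hi hj)
      · have hem : e ∈ mergedEdges φ ψ := ⟨x i, y j, hij, hi, hj, hxe i, hye j⟩
        have hcard : (mergedEdges φ ψ \ D).ncard = (mergedEdges φ ψ \ insert e D).ncard + 1 := by
          have : mergedEdges φ ψ \ D = insert e (mergedEdges φ ψ \ insert e D) := by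
            ext f
            by_cases hf : f = e
            · subst hf
              simpa [hem] using he
            · simp [hf]
          rw [this, Set.ncard_insert_of_notMem (by simp)]
        rw [hcard]
        exact canPlay_succ.2 ⟨i, j, h.legal h1 hij hi hj, h.symm.legal h2 (Ne.symm hij) hj hi,
          ih _ hD' _ _ _ _ (h.move he hij hi hj)⟩

theorem ncard_mergedEdges_le_nine {E : Type} [Finite E] {φ ψ : Equiv.Perm (E ⊕ Fin 4)} {r : E → ℕ}
    (hφ : ∀ e f, e ≠ f → φ (.inl e) = .inl f → r e < r f)
    (hψ : ∀ e f, e ≠ f → ψ (.inl e) = .inl f → r e < r f)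
    (h1 : ∀ a, ¬ Relation.TransGen (Detour φ ψ) a a)
    (h2 : ∀ a, ¬ Relation.TransGen (Detour ψ φ) a a) : (mergedEdges φ ψ).ncard ≤ 9 := by
  have := GamePosition.canPlay_ncard hφ hψ h1 h2 _ ∅ rfl _ _ _ _ .init
  rw [Set.sdiff_empty] at this
  exact le_nine_of_canPlay this

/-! ### Path sets and routings -/

namespace Network

variable {V E : Type} {G : Network V E}

/-- In a finite acyclic network the edges can be ranked so that ranks increase along paths. -/
theorem Acyclic.exists_rank [Finite E] (h : G.Acyclic) :
    ∃ r : E → ℕ, ∀ e f, G.tgt e = G.src f → r e < r f := by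
  have hpath : ∀ e f, Relation.TransGen (fun e f => G.tgt e = G.src f) e f →
      ∃ p, G.IsPath (G.src e) (G.src f) (e :: p) := by
    intro e f hef
    induction hef using Relation.TransGen.head_induction_on with
    | single h => exact ⟨[], rfl, h⟩
    | head h _ ih =>
      obtain ⟨p, hp⟩ := ih
      exact ⟨_, rfl, h ▸ hp⟩
  refine ⟨fun f => {e | Relation.TransGen (fun e f => G.tgt e = G.src f) e f}.ncard, ?_⟩
  intro e f hef
  refine Set.ncard_lt_ncard ⟨fun g hg => hg.tail hef, fun hsub => ?_⟩ (Set.toFinite _)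
  obtain ⟨p, hp⟩ := hpath e e (hsub (a := e) (.single hef))
  exact List.cons_ne_nil _ _ (h _ _ hp)

theorem IsPath.rank_lt {r : E → ℕ} (hr : ∀ e f, G.tgt e = G.src f → r e < r f) :
    ∀ {p : List E} {u v : V}, G.IsPath u v p → ∀ e, G.tgt e = u → ∀ f ∈ p, r e < r f
  | [], _, _, _, _, _, f, hf => absurd hf List.not_mem_nil
  | g :: p, u, v, ⟨hg, hp⟩, e, he, f, hf => by
    have heg : r e < r g := hr e g (he.trans hg.symm)
    rcases List.mem_cons.1 hf with rfl | hf
    · exact heg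
    · exact heg.trans (hp.rank_lt hr g rfl f hf)

/-- The path `p` is spliced into a routing: its last edge takes over the image of token `i`. -/
theorem exists_perm_of_isPath {r : E → ℕ} (hr : ∀ e f, G.tgt e = G.src f → r e < r f) {R : V}
    {φ : Equiv.Perm (E ⊕ Fin 4)} {i j : Fin 4} (hi : φ (.inr i) = .inr j)
    (hadj : ∀ e f, φ (.inl e) = .inl f → e = f ∨ G.tgt e = G.src f)
    (hfin : ∀ e i, φ (.inl e) = .inr i → G.tgt e = R) :
    ∀ {p : List E} {u : V}, G.IsPath u R p → (∀ e ∈ p, φ (.inl e) = .inl e) →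
      ∃ φ' : Equiv.Perm (E ⊕ Fin 4),
        (∀ e f, φ' (.inl e) = .inl f → e = f ∨ G.tgt e = G.src f) ∧
        (∀ e i, φ' (.inl e) = .inr i → G.tgt e = R) ∧
        (∀ k ≠ i, φ' (.inr k) = φ (.inr k)) ∧ (∀ e ∉ p, φ' (.inl e) = φ (.inl e)) ∧
        (match p with
          | [] => u = R ∧ φ' (.inr i) = .inr j
          | e :: _ => G.src e = u ∧ φ' (.inr i) = .inl e)
  | [], u, hp, _ => ⟨φ, hadj, hfin, fun _ _ => rfl, fun _ _ => rfl, hp, hi⟩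
  | e :: p, u, ⟨he, hp⟩, hfix => by
    classical
    obtain ⟨φ', h1, h2, h3, h4, h5⟩ := exists_perm_of_isPath hr hi hadj hfin hp
      fun f hf => hfix f (List.mem_cons_of_mem e hf)
    have hep : e ∉ p := fun hep => lt_irrefl _ (hp.rank_lt hr e rfl e hep)
    have hswap : ∀ f ≠ e, Equiv.swap (.inr i : E ⊕ Fin 4) (.inl e) (.inl f) = .inl f := fun f hf =>
      Equiv.swap_apply_of_ne_of_ne (by simp) (by simpa using hf)
    refine ⟨φ' * Equiv.swap (.inr i) (.inl e), ?_, ?_, ?_, ?_, he, ?_⟩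
    · intro f g hfg
      by_cases hf : f = e
      · subst hf
        rw [Equiv.Perm.mul_apply, Equiv.swap_apply_right] at hfg
        cases p with
        | nil => simp [h5.2] at hfg
        | cons e' p =>
          obtain rfl : e' = g := by simpa [h5.2] using hfg
          exact .inr h5.1.symm
      · rw [Equiv.Perm.mul_apply, hswap f hf] at hfg
        exact h1 f g hfg
    · intro f k hfk
      by_cases hf : f = e
      · subst hf
        rw [Equiv.Perm.mul_apply, Equiv.swap_apply_right] at hfk
        cases p with
        | nil => exact h5.1
        | cons e' p => simp [h5.2] at hfk
      · rw [Equiv.Perm.mul_apply, hswap f hf] at hfk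
        exact h2 f k hfk
    · intro k hk
      rw [Equiv.Perm.mul_apply, Equiv.swap_apply_of_ne_of_ne (by simpa using hk) (by simp)]
      exact h3 k hk
    · intro f hf
      rw [List.mem_cons, not_or] at hf
      rw [Equiv.Perm.mul_apply, hswap f hf.1]
      exact h4 f hf.2
    · rw [Equiv.Perm.mul_apply, Equiv.swap_apply_left, h4 e hep]
      exact hfix e List.mem_cons_self

/-- The tokens in use. -/
def usedTokens (φ : Equiv.Perm (E ⊕ Fin 4)) : Finset (Fin 4) :=
  Finset.univ.filter fun i => (φ (.inr i)).isLeft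

theorem mem_usedTokens {φ : Equiv.Perm (E ⊕ Fin 4)} {i : Fin 4} :
    i ∈ usedTokens φ ↔ ∃ e, φ (.inr i) = .inl e := by
  simp [usedTokens, Sum.isLeft_iff]

theorem IsDisjointPathSet.exists_isRouting {r : E → ℕ}
    (hr : ∀ e f, G.tgt e = G.src f → r e < r f) {S R : V} (hSR : S ≠ R) {A : Finset (List E)}
    (hA : G.IsDisjointPathSet S R A) (hcard : A.card ≤ 4) :
    ∃ φ, G.IsRouting S R φ ∧ A.card ≤ (usedTokens φ).card := by
  classical
  suffices ∃ φ, G.IsRouting S R φ ∧ A.card ≤ (usedTokens φ).card ∧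
      ∀ e, (∀ p ∈ A, e ∉ p) → φ (.inl e) = .inl e by
    obtain ⟨φ, h1, h2, -⟩ := this
    exact ⟨φ, h1, h2⟩
  induction A using Finset.induction_on with
  | empty =>
    exact ⟨1, ⟨fun e f h => .inl (Sum.inl.inj h), fun i f h => by simp at h,
      fun e i h => by simp at h⟩, by simp, fun _ _ => rfl⟩
  | insert p A hpA ih =>
    rw [Finset.card_insert_of_notMem hpA] at hcard
    obtain ⟨φ, hφ, hle, hfix⟩ := ih ⟨fun q hq => hA.1 q (Finset.mem_insert_of_mem hq),
      fun q hq q' hq' => hA.2 q (Finset.mem_insert_of_mem hq) q' (Finset.mem_insert_of_mem hq')⟩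
      (by omega)
    rw [Finset.card_insert_of_notMem hpA]
    rcases hle.lt_or_eq with hlt | heq
    · exact ⟨φ, hφ, hlt, fun e he => hfix e fun q hq => he q (Finset.mem_insert_of_mem hq)⟩
    obtain ⟨i, hi⟩ : ∃ i, i ∉ usedTokens φ := by
      by_contra! hall
      have : usedTokens φ = Finset.univ := Finset.eq_univ_iff_forall.2 hall
      rw [this, Finset.card_univ, Fintype.card_fin] at heq
      omega
    obtain ⟨j, hj⟩ : ∃ j, φ (.inr i) = .inr j := by
      rcases h : φ (.inr i) with e | j
      · exact absurd (mem_usedTokens.2 ⟨e, h⟩) hi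
      · exact ⟨j, rfl⟩
    obtain ⟨φ', h1, h2, h3, h4, h5⟩ := exists_perm_of_isPath hr hj hφ.adj hφ.finish
      (hA.1 p (Finset.mem_insert_self p A)) fun e he => hfix e fun q hq heq =>
        hA.2 p (Finset.mem_insert_self p A) q (Finset.mem_insert_of_mem hq)
          (by rintro rfl; exact hpA hq) he heq
    obtain ⟨e, hes, hei⟩ : ∃ e, G.src e = S ∧ φ' (.inr i) = .inl e := by
      cases p with
      | nil => exact absurd h5.1 hSR
      | cons e p => exact ⟨e, h5⟩
    refine ⟨φ', ⟨h1, ?_, h2⟩, ?_, ?_⟩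
    · intro k f hk
      by_cases hki : k = i
      · subst hki
        obtain rfl : e = f := by simpa [hei] using hk
        exact hes
      · rw [h3 k hki] at hk
        exact hφ.start k f hk
    · have : insert i (usedTokens φ) ⊆ usedTokens φ' := by
        intro k hk
        by_cases hki : k = i
        · subst hki
          exact mem_usedTokens.2 ⟨e, hei⟩
        · rw [mem_usedTokens, h3 k hki, ← mem_usedTokens]
          exact (Finset.mem_insert.1 hk).resolve_left hki
      have := Finset.card_le_card this
      rw [Finset.card_insert_of_notMem hi] at this
      omega
    · intro f hf
      rw [h4 f (hf p (Finset.mem_insert_self p A))]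
      exact hfix f fun q hq => hf q (Finset.mem_insert_of_mem hq)

/-- Consecutive edges on a path of a routing. -/
def RoutingStep (φ : Equiv.Perm (E ⊕ Fin 4)) (f e : E) : Prop :=
  φ (.inl f) = .inl e ∧ f ≠ e

theorem exists_path_of_isRouting [Finite E] {r : E → ℕ}
    (hr : ∀ e f, G.tgt e = G.src f → r e < r f) {S R : V} {φ : Equiv.Perm (E ⊕ Fin 4)}
    (hφ : G.IsRouting S R φ) : ∀ (e : E), φ (.inl e) ≠ .inl e →
      ∃ p, G.IsPath (G.src e) R (e :: p) ∧ (e :: p).IsChain (RoutingStep φ) := by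
  have hwf : WellFounded fun e f : E => r f < r e := by
    have : IsStrictOrder E fun e f : E => r f < r e :=
      { irrefl := fun _ => lt_irrefl _, trans := fun _ _ _ h1 h2 => h2.trans h1 }
    exact Finite.wellFounded_of_trans_of_irrefl _
  intro e
  induction e using hwf.induction with
  | _ e ih =>
    intro he
    rcases h : φ (.inl e) with f | i
    · have hef : e ≠ f := by
        rintro rfl
        exact he h
      have hadj := (hφ.adj e f h).resolve_left hef
      obtain ⟨p, hp, hc⟩ := ih f (hr e f hadj) fun hf =>
        hef (Sum.inl.inj (φ.injective (h.trans hf.symm)))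
      exact ⟨f :: p, ⟨rfl, hadj ▸ hp⟩, List.isChain_cons_cons.2 ⟨⟨h, hef⟩, hc⟩⟩
    · exact ⟨[], ⟨rfl, hφ.finish e i h⟩, List.isChain_singleton e⟩

theorem eq_or_exists_of_isChain {s : E → E → Prop} : ∀ {e : E} {p : List E},
    (e :: p).IsChain s → ∀ g ∈ e :: p, g = e ∨ ∃ f ∈ e :: p, s f g
  | e, [], _, g, hg => .inl (List.mem_singleton.1 hg)
  | e, e' :: p, h, g, hg => by
    rw [List.isChain_cons_cons] at h
    rcases List.mem_cons.1 hg with rfl | hg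
    · exact .inl rfl
    right
    rcases eq_or_exists_of_isChain h.2 g hg with rfl | ⟨f, hf, hfg⟩
    · exact ⟨e, List.mem_cons_self, h.1⟩
    · exact ⟨f, List.mem_cons_of_mem e hf, hfg⟩

theorem IsRouting.disjoint_of_isChain {r : E → ℕ} (hr : ∀ e f, G.tgt e = G.src f → r e < r f)
    {S R : V} {φ : Equiv.Perm (E ⊕ Fin 4)} (hφ : G.IsRouting S R φ) {i j : Fin 4} (hij : i ≠ j)
    {e e' : E} {p p' : List E} (hi : φ (.inr i) = .inl e) (hj : φ (.inr j) = .inl e')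
    (hp : (e :: p).IsChain (RoutingStep φ)) (hp' : (e' :: p').IsChain (RoutingStep φ)) :
    List.Disjoint (e :: p) (e' :: p') := by
  -- otherwise consider a common edge of least rank and the edges before it
  suffices ∀ n g, r g = n → g ∈ e :: p → g ∈ e' :: p' → False from
    fun g hg hg' => this _ g rfl hg hg'
  intro n
  induction n using Nat.strong_induction_on with
  | _ n ih =>
    intro g hn hg hg'
    rcases eq_or_exists_of_isChain hp g hg with rfl | ⟨f, hf, hfg⟩ <;>
      rcases eq_or_exists_of_isChain hp' g hg' with rfl | ⟨f', hf', hfg'⟩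
    · exact hij (Sum.inr.inj (φ.injective (hi.trans hj.symm)))
    · exact absurd (φ.injective (hi.trans hfg'.1.symm)) (by simp)
    · exact absurd (φ.injective (hj.trans hfg.1.symm)) (by simp)
    · obtain rfl := Sum.inl.inj (φ.injective (hfg.1.trans hfg'.1.symm))
      exact ih _ (hn ▸ hr f g ((hφ.adj f g hfg.1).resolve_left hfg.2)) f rfl hf hf'

theorem IsRouting.exists_isDisjointPathSet [Finite E] {r : E → ℕ}
    (hr : ∀ e f, G.tgt e = G.src f → r e < r f) {S R : V} {φ : Equiv.Perm (E ⊕ Fin 4)}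
    (hφ : G.IsRouting S R φ) : ∃ A : Finset (List E), G.IsDisjointPathSet S R A ∧
      A.card = (usedTokens φ).card ∧
      ∀ p ∈ A, ∀ f e, [f, e] <:+: p → φ (.inl f) = .inl e ∧ f ≠ e := by
  classical
  have hpath : ∀ i ∈ usedTokens φ, ∃ e p, φ (.inr i) = .inl e ∧ G.IsPath S R (e :: p) ∧
      (e :: p).IsChain (RoutingStep φ) := by
    intro i hi
    obtain ⟨e, he⟩ := mem_usedTokens.1 hi
    obtain ⟨p, hp, hc⟩ := exists_path_of_isRouting hr hφ e fun h =>
      absurd (φ.injective (h.trans he.symm)) (by simp)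
    exact ⟨e, p, he, hφ.start i e he ▸ hp, hc⟩
  choose e p he hp hc using hpath
  let P : usedTokens φ → List E := fun i => e i i.2 :: p i i.2
  have hdis : ∀ i j, i ≠ j → List.Disjoint (P i) (P j) := fun i j hij =>
    hφ.disjoint_of_isChain hr (fun h => hij (Subtype.ext h)) (he i i.2) (he j j.2) (hc i i.2)
      (hc j j.2)
  have hinj : Function.Injective P := by
    intro i j hij
    by_contra hne
    exact hdis i j hne (a := e i i.2) List.mem_cons_self (hij ▸ List.mem_cons_self)
  refine ⟨Finset.univ.image P, ⟨?_, ?_⟩, ?_, ?_⟩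
  · intro q hq
    obtain ⟨i, -, rfl⟩ := Finset.mem_image.1 hq
    exact hp i i.2
  · intro q hq q' hq' hne
    obtain ⟨i, -, rfl⟩ := Finset.mem_image.1 hq
    obtain ⟨j, -, rfl⟩ := Finset.mem_image.1 hq'
    exact hdis i j fun h => hne (h ▸ rfl)
  · rw [Finset.card_image_of_injective _ hinj, Finset.card_univ, Fintype.card_coe]
  · intro q hq f g hfg
    obtain ⟨i, -, rfl⟩ := Finset.mem_image.1 hq
    exact (List.isChain_pair (R := RoutingStep φ)).1 ((hc i i.2).infix hfg)

/-! ### Weak duality -/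

/-- Weak duality: disjoint paths pass through distinct edges of a cut. -/
theorem IsDisjointPathSet.card_le_encard {S R : V} {A : Finset (List E)}
    (hA : G.IsDisjointPathSet S R A) {C : Set E} (hC : G.IsCut S R C) : (A.card : ℕ∞) ≤ C.encard := by
  have hcut : ∀ p : A, ∃ e : C, e.1 ∈ p.1 := fun p => by
    obtain ⟨e, he, heC⟩ := hC p (hA.1 p p.2)
    exact ⟨⟨e, heC⟩, he⟩
  choose c hc using hcut
  have hinj : Function.Injective c := by
    intro p q hpq
    by_contra hne
    exact hA.2 p p.2 q q.2 (fun h => hne (Subtype.ext h)) (hc p) (hpq ▸ hc q)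
  have := ENat.card_le_card_of_injective hinj
  rwa [ENat.card_eq_coe_fintype_card, Fintype.card_coe] at this

theorem IsDisjointPathSet.card_le_minCut {S R : V} {A : Finset (List E)}
    (hA : G.IsDisjointPathSet S R A) : (A.card : ℕ∞) ≤ G.minCut S R :=
  le_iInf₂ fun _ hC => hA.card_le_encard hC

theorem exists_isMengerSet {S R : V} {c : ℕ} (h : G.minCut S R = c) :
    ∃ A, G.IsMengerSet S R A ∧ A.card ≤ c := by
  classical
  have hb : ∀ A, G.IsDisjointPathSet S R A → A.card ≤ c := fun A hA => by
    exact_mod_cast h ▸ hA.card_le_minCut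
  let P : ℕ → Prop := fun n => ∃ A, G.IsDisjointPathSet S R A ∧ A.card = n
  have h0 : P 0 := ⟨∅, ⟨by simp, by simp⟩, rfl⟩
  obtain ⟨A, hA, hcard⟩ := Nat.findGreatest_spec (P := P) (Nat.zero_le c) h0
  exact ⟨A, ⟨hA, fun B hB => hcard ▸ Nat.le_findGreatest (hb B hB) ⟨B, hB, rfl⟩⟩, hb A hA⟩

/-! ### The upper bound -/

theorem minMergings_le_nine [Finite E] (hG : G.Acyclic) {S : V} {R : Fin 2 → V}
    (hR : ∀ i, G.minCut S (R i) = (4 : ℕ)) : G.minMergings S R ≤ 9 := by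
  obtain ⟨r, hr⟩ := hG.exists_rank
  have hne : ∀ i, S ≠ R i := by
    rintro i h
    have : G.minCut S (R i) = ⊤ := by
      refine iInf₂_eq_top.2 fun C hC => ?_
      obtain ⟨e, he, -⟩ := hC [] h
      exact absurd he List.not_mem_nil
    rw [hR i] at this
    exact ENat.natCast_ne_top 4 this
  obtain ⟨A, hA, hA4⟩ := exists_isMengerSet (hR 0)
  obtain ⟨B, hB, hB4⟩ := exists_isMengerSet (hR 1)
  -- a pair of routings with as many paths as possible and as few steps as possible
  let Z : Set (Equiv.Perm (E ⊕ Fin 4) × Equiv.Perm (E ⊕ Fin 4)) :=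
    {t | G.IsRouting S (R 0) t.1 ∧ A.card ≤ (usedTokens t.1).card ∧
      G.IsRouting S (R 1) t.2 ∧ B.card ≤ (usedTokens t.2).card}
  have hZ : Z.Nonempty := by
    obtain ⟨φ, h1, h2⟩ := hA.1.exists_isRouting hr (hne 0) hA4
    obtain ⟨ψ, h3, h4⟩ := hB.1.exists_isRouting hr (hne 1) hB4
    exact ⟨(φ, ψ), h1, h2, h3, h4⟩
  obtain ⟨⟨φ, ψ⟩, ⟨hφ, hφA, hψ, hψB⟩, hmin⟩ :=
    Z.toFinite.exists_minimalFor (fun t => (usedSteps t.1 t.2).ncard) _ hZ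
  have hle : ∀ {φ φ' : Equiv.Perm (E ⊕ Fin 4)},
      (∀ i, (φ (.inr i)).isLeft → (φ' (.inr i)).isLeft) →
      (usedTokens φ).card ≤ (usedTokens φ').card := fun h =>
    Finset.card_le_card (Finset.monotone_filter_right _ fun i _ => h i)
  have h1 : ∀ a, ¬ Relation.TransGen (Detour φ ψ) a a := by
    intro a ha
    obtain ⟨φ', hφ', hleft, hlt⟩ := exists_usedSteps_ssubset hr hφ hψ ha
    have hlt := Set.ncard_lt_ncard hlt (Set.toFinite _)
    exact absurd (hmin (j := (φ', ψ)) ⟨hφ', hφA.trans (hle hleft), hψ, hψB⟩ hlt.le) (not_le.2 hlt)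
  have h2 : ∀ a, ¬ Relation.TransGen (Detour ψ φ) a a := by
    intro a ha
    obtain ⟨ψ', hψ', hleft, hlt⟩ := exists_usedSteps_ssubset hr hψ hφ ha
    rw [usedSteps_comm ψ', usedSteps_comm ψ] at hlt
    have hlt := Set.ncard_lt_ncard hlt (Set.toFinite _)
    exact absurd (hmin (j := (φ, ψ')) ⟨hφ, hφA, hψ', hψB.trans (hle hleft)⟩ hlt.le) (not_le.2 hlt)
  have h9 : (mergedEdges φ ψ).ncard ≤ 9 := ncard_mergedEdges_le_nine (r := r)
    (fun e f hef h => hr e f ((hφ.adj e f h).resolve_left hef))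
    (fun e f hef h => hr e f ((hψ.adj e f h).resolve_left hef)) h1 h2
  obtain ⟨A', hA', hA'card, hA'step⟩ := hφ.exists_isDisjointPathSet hr
  obtain ⟨B', hB', hB'card, hB'step⟩ := hψ.exists_isDisjointPathSet hr
  refine (iInf₂_le ![A', B'] ?_).trans (?_ : _ ≤ ((9 : ℕ) : ℕ∞))
  · intro i
    fin_cases i
    · exact ⟨hA', fun C hC => (hA.2 C hC).trans (hφA.trans hA'card.ge)⟩
    · exact ⟨hB', fun C hC => (hB.2 C hC).trans (hψB.trans hB'card.ge)⟩
  · have hsub : mergingEdges ![A', B'] ⊆ mergedEdges φ ψ := by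
      rintro e ⟨i, j, hij, β, hβ, γ, hγ, f, g, hfg, hf, hg⟩
      fin_cases i <;> fin_cases j
      · exact absurd rfl hij
      · obtain ⟨hf, hfe⟩ := hA'step β hβ f e hf
        obtain ⟨hg, hge⟩ := hB'step γ hγ g e hg
        exact ⟨.inl f, .inl g, by simpa using hfg, hf, hg, by simpa using hfe, by simpa using hge⟩
      · obtain ⟨hf, hfe⟩ := hB'step β hβ f e hf
        obtain ⟨hg, hge⟩ := hA'step γ hγ g e hg
        exact ⟨.inl g, .inl f, by simpa using hfg.symm, hg, hf, by simpa using hge,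
          by simpa using hfe⟩
      · exact absurd rfl hij
    refine (Set.encard_le_encard hsub).trans ?_
    rw [← (Set.toFinite (mergedEdges φ ψ)).cast_ncard_eq]
    exact_mod_cast h9

end Network

/-! ### Certifying mergings by potentials -/

namespace Network

variable {V E : Type} {G : Network V E}

theorem IsPath.nodup {r : E → ℕ} (hr : ∀ e f, G.tgt e = G.src f → r e < r f) :
    ∀ {p : List E} {u v : V}, G.IsPath u v p → p.Nodup
  | [], _, _, _ => List.nodup_nil
  | e :: _, _, _, ⟨_, hp⟩ =>
    List.nodup_cons.2 ⟨fun he => lt_irrefl _ (hp.rank_lt hr e rfl e he), hp.nodup hr⟩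

theorem IsPath.sum_potential (h : V → ℤ) : ∀ {p : List E} {u v : V}, G.IsPath u v p →
    (p.map fun e => h (G.tgt e) - h (G.src e)).sum = h v - h u
  | [], _, _, hp => by
    obtain rfl : _ = _ := hp
    simp
  | e :: p, u, v, ⟨he, hp⟩ => by
    rw [List.map_cons, List.sum_cons, hp.sum_potential h, he]
    ring

theorem IsPath.isChain : ∀ {p : List E} {u v : V}, G.IsPath u v p →
    p.IsChain fun e f => G.tgt e = G.src f
  | [], _, _, _ => List.isChain_nil
  | [e], _, _, _ => List.isChain_singleton e
  | _ :: _ :: _, _, _, hp => List.isChain_cons_cons.2 ⟨hp.2.1.symm, IsPath.isChain hp.2⟩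

theorem IsPath.exists_infix_pair {p : List E} {u v : V} (hp : G.IsPath u v p) {e : E} (he : e ∈ p)
    (hne : G.src e ≠ u) : ∃ f, [f, e] <:+: p ∧ G.tgt f = G.src e := by
  cases p with
  | nil => exact absurd he List.not_mem_nil
  | cons g p =>
    rcases eq_or_exists_of_isChain (List.isChain_isInfix (g :: p)) e he with rfl | ⟨f, -, hf⟩
    · exact absurd hp.1 hne
    · exact ⟨f, hf, (List.isChain_pair (R := fun e f => G.tgt e = G.src f)).1 (hp.isChain.infix hf)⟩

/-- If a potential increases along certain edges only, and the total increase there is what `n`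
disjoint paths from `S` to `R` need, then `n` disjoint paths use exactly these edges. -/
theorem IsDisjointPathSet.mem_iff_of_potential [Fintype E] {r : E → ℕ}
    (hr : ∀ e f, G.tgt e = G.src f → r e < r f) {S R : V} {A : Finset (List E)}
    (hA : G.IsDisjointPathSet S R A) (h : V → ℤ) (hne : ∀ e, h (G.tgt e) - h (G.src e) ≠ 0)
    (hsum : ∑ e, max (h (G.tgt e) - h (G.src e)) 0 = A.card * (h R - h S)) (e : E) :
    (∃ p ∈ A, e ∈ p) ↔ 0 < h (G.tgt e) - h (G.src e) := by
  classical
  set δ : E → ℤ := fun e => h (G.tgt e) - h (G.src e) with hδ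
  let U : Finset E := A.biUnion List.toFinset
  have hU : ∑ e ∈ U, δ e = A.card * (h R - h S) := by
    rw [Finset.sum_biUnion]
    · rw [← nsmul_eq_mul]
      refine Finset.sum_eq_card_nsmul fun p hp => ?_
      rw [List.sum_toFinset _ ((hA.1 p hp).nodup hr)]
      exact (hA.1 p hp).sum_potential h
    · intro p hp q hq hpq
      exact List.disjoint_toFinset_iff_disjoint.2 (hA.2 p hp q hq hpq)
  have hle : ∀ e ∈ Finset.univ, (if e ∈ U then δ e else 0) ≤ max (δ e) 0 := by
    intro e _
    split_ifs
    · exact le_max_left _ _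
    · exact le_max_right _ _
  have heq := (Finset.sum_eq_sum_iff_of_le hle).1 (by
    rw [← Finset.sum_filter, Finset.filter_mem_eq_inter, Finset.univ_inter, hU, ← hsum]) e
      (Finset.mem_univ e)
  have hmem : e ∈ U ↔ ∃ p ∈ A, e ∈ p := by simp [U]
  rw [← hmem]
  have hne' : δ e ≠ 0 := hne e
  change e ∈ U ↔ 0 < δ e
  by_cases he : e ∈ U
  · rw [if_pos he] at heq
    have := le_max_right (δ e) 0
    exact iff_of_true he (by omega)
  · rw [if_neg he] at heq
    have := le_max_left (δ e) 0
    exact iff_of_false he (by omega)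

end Network

/-! ### A network with nine mergings -/

/-- The network in which paths `φ₀, …, φ₃` to `23` and `ψ₀, …, ψ₃` to `24` leave the source `0`,
`φᵢ` and `ψᵢ` along the common edge `i`, and merge in the order `(φ₀, ψ₁)`, `(φ₀, ψ₂)`, `(φ₀, ψ₃)`,
`(φ₂, ψ₃)`, `(φ₁, ψ₃)`, `(φ₁, ψ₁)`, `(φ₁, ψ₂)`, `(φ₂, ψ₂)`, `(φ₂, ψ₁)`. The `k`-th merging is at the
edge `6 + 3 * k`, to which the two paths come along `4 + 3 * k` and `5 + 3 * k`. -/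
def nineNet : Network (Fin 25) (Fin 39) where
  src := ![0, 0, 0, 0, 1, 2, 5, 6, 3, 7, 8, 4, 9, 3, 10, 11, 2, 12, 13, 14, 6, 15, 16, 8, 17, 12,
    18, 19, 20, 16, 21, 10, 18, 22, 4, 1, 22, 20, 14]
  tgt := ![1, 2, 3, 4, 5, 5, 6, 7, 7, 8, 9, 9, 10, 11, 11, 12, 13, 13, 14, 15, 15, 16, 17, 17, 18,
    19, 19, 20, 21, 21, 22, 23, 23, 23, 23, 24, 24, 24, 24]

/-- Increases along the edges of `φ₀, …, φ₃` only. -/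
def ninePot₁ : Fin 25 → ℤ :=
  ![0, 1, 3, 9, 19, 2, 7, 8, 17, 18, 19, 10, 11, 4, 5, 6, 15, 16, 17, 12, 13, 14, 15, 20, 0]

/-- Increases along the edges of `ψ₀, …, ψ₃` only. -/
def ninePot₂ : Fin 25 → ℤ :=
  ![0, 15, 13, 5, 1, 14, 15, 6, 7, 2, 3, 4, 11, 12, 17, 16, 17, 8, 9, 10, 19, 18, 19, 0, 20]

/-- The paths `φ₀, …, φ₃`. -/
def ninePaths₁ : Finset (List (Fin 39)) :=
  {[0, 4, 6, 7, 9, 10, 12, 31], [1, 16, 18, 19, 21, 22, 24, 32], [2, 13, 15, 25, 27, 28, 30, 33],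
    [3, 34]}

/-- The paths `ψ₀, …, ψ₃`. -/
def ninePaths₂ : Finset (List (Fin 39)) :=
  {[0, 35], [1, 5, 6, 20, 21, 29, 30, 36], [2, 8, 9, 23, 24, 26, 27, 37],
    [3, 11, 12, 14, 15, 17, 18, 38]}

namespace Network

theorem nineNet_src_lt_tgt : ∀ e, nineNet.src e < nineNet.tgt e := by decide +kernel

theorem nineNet_rank (e f : Fin 39) (h : nineNet.tgt e = nineNet.src f) :
    (nineNet.src e).1 < (nineNet.src f).1 :=
  h ▸ nineNet_src_lt_tgt e

theorem nineNet_acyclic : nineNet.Acyclic := by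
  have key : ∀ (p : List (Fin 39)) (u v : Fin 25), nineNet.IsPath u v p → u ≤ v := by
    intro p
    induction p with
    | nil => exact fun u v h => le_of_eq h
    | cons e p ih =>
      exact fun u v h => h.1 ▸ (nineNet_src_lt_tgt e).le.trans (ih _ _ h.2)
  intro v p hp
  cases p with
  | nil => rfl
  | cons e p =>
    exact absurd ((nineNet_src_lt_tgt e).trans_le (key _ _ _ hp.2)) (by rw [hp.1]; exact lt_irrefl v)

theorem ninePaths₁_isDisjointPathSet : nineNet.IsDisjointPathSet 0 23 ninePaths₁ := by
  refine ⟨?_, by unfold ninePaths₁ List.Disjoint; decide +kernel⟩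
  simp only [ninePaths₁, Finset.mem_insert, Finset.mem_singleton]
  rintro p (rfl | rfl | rfl | rfl)
  all_goals simp only [IsPath]; decide +kernel

theorem ninePaths₂_isDisjointPathSet : nineNet.IsDisjointPathSet 0 24 ninePaths₂ := by
  refine ⟨?_, by unfold ninePaths₂ List.Disjoint; decide +kernel⟩
  simp only [ninePaths₂, Finset.mem_insert, Finset.mem_singleton]
  rintro p (rfl | rfl | rfl | rfl)
  all_goals simp only [IsPath]; decide +kernel

theorem nineNet_isCut {R : Fin 25} (hR : R ≠ 0) :
    nineNet.IsCut 0 R ((({0, 1, 2, 3} : Finset (Fin 39))) : Set (Fin 39)) := by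
  intro p hp
  cases p with
  | nil => exact absurd hp.symm hR
  | cons e p =>
    refine ⟨e, List.mem_cons_self, ?_⟩
    have : ∀ e, nineNet.src e = 0 → e ∈ ({0, 1, 2, 3} : Finset (Fin 39)) := by decide +kernel
    exact_mod_cast this e hp.1

theorem nineNet_minCut {R : Fin 25} (hR : R ≠ 0) {A : Finset (List (Fin 39))}
    (hA : nineNet.IsDisjointPathSet 0 R A) (hcard : A.card = 4) :
    nineNet.minCut 0 R = (4 : ℕ) := by
  refine le_antisymm ((iInf₂_le _ (nineNet_isCut hR)).trans ?_) ?_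
  · rw [Set.encard_coe_eq_coe_finsetCard]
    rfl
  · exact hcard ▸ hA.card_le_minCut

theorem card_eq_four_of_isMengerSet {R : Fin 25} (hR : R ≠ 0) {A B : Finset (List (Fin 39))}
    (hA : nineNet.IsDisjointPathSet 0 R A) (hcard : A.card = 4) (hB : nineNet.IsMengerSet 0 R B) :
    B.card = 4 := by
  have h1 := hB.2 A hA
  have h2 := hB.1.card_le_minCut
  rw [nineNet_minCut hR hA hcard] at h2
  have h2 : B.card ≤ 4 := by exact_mod_cast h2
  omega

/-- A Menger set whose edges are those along which the potential increases comes to an edge along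
the only such edge that leads there. -/
theorem exists_infix_of_potential {R : Fin 25} {A : Finset (List (Fin 39))}
    (hA : nineNet.IsDisjointPathSet 0 R A) {h : Fin 25 → ℤ}
    (hmem : ∀ e, (∃ p ∈ A, e ∈ p) ↔ 0 < h (nineNet.tgt e) - h (nineNet.src e)) {e f : Fin 39}
    (he : 0 < h (nineNet.tgt e) - h (nineNet.src e)) (hsrc : nineNet.src e ≠ 0)
    (hf : ∀ g, nineNet.tgt g = nineNet.src e →
      0 < h (nineNet.tgt g) - h (nineNet.src g) → g = f) : ∃ p ∈ A, [f, e] <:+: p := by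
  obtain ⟨p, hp, hep⟩ := (hmem e).2 he
  obtain ⟨g, hg, hge⟩ := (hA.1 p hp).exists_infix_pair hep hsrc
  obtain rfl := hf g hge ((hmem g).1 ⟨p, hp, hg.subset (by simp)⟩)
  exact ⟨p, hp, hg⟩

/-- The edge of the `k`-th merging in `nineNet`. -/
def nineEdge (k : Fin 9) : Fin 39 := ⟨6 + 3 * k, by omega⟩

/-- The edge along which a path to `23` comes to the `k`-th merging in `nineNet`. -/
def nineEntry₁ (k : Fin 9) : Fin 39 := ⟨4 + 3 * k, by omega⟩

/-- The edge along which a path to `24` comes to the `k`-th merging in `nineNet`. -/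
def nineEntry₂ (k : Fin 9) : Fin 39 := ⟨5 + 3 * k, by omega⟩

theorem nineEdge_injective : Function.Injective nineEdge := by decide +kernel

theorem nine_le_minMergings : 9 ≤ nineNet.minMergings 0 ![23, 24] := by
  refine le_iInf₂ fun α hα => ?_
  have h1 : nineNet.IsMengerSet 0 23 (α 0) := hα 0
  have h2 : nineNet.IsMengerSet 0 24 (α 1) := hα 1
  have hc1 := card_eq_four_of_isMengerSet (by decide) ninePaths₁_isDisjointPathSet (by decide) h1
  have hc2 := card_eq_four_of_isMengerSet (by decide) ninePaths₂_isDisjointPathSet (by decide) h2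
  have hmem1 := h1.1.mem_iff_of_potential nineNet_rank ninePot₁ (by decide +kernel)
    (by rw [hc1]; decide +kernel)
  have hmem2 := h2.1.mem_iff_of_potential nineNet_rank ninePot₂ (by decide +kernel)
    (by rw [hc2]; decide +kernel)
  have hsub : Set.range nineEdge ⊆ mergingEdges α := by
    rintro _ ⟨k, rfl⟩
    have hsrc : ∀ k, nineNet.src (nineEdge k) ≠ 0 := by decide +kernel
    have hpos : ∀ k, 0 < ninePot₁ (nineNet.tgt (nineEdge k)) - ninePot₁ (nineNet.src (nineEdge k)) ∧
        0 < ninePot₂ (nineNet.tgt (nineEdge k)) - ninePot₂ (nineNet.src (nineEdge k)) := by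
      decide +kernel
    have hent₁ : ∀ k g, nineNet.tgt g = nineNet.src (nineEdge k) →
        0 < ninePot₁ (nineNet.tgt g) - ninePot₁ (nineNet.src g) → g = nineEntry₁ k := by
      decide +kernel
    have hent₂ : ∀ k g, nineNet.tgt g = nineNet.src (nineEdge k) →
        0 < ninePot₂ (nineNet.tgt g) - ninePot₂ (nineNet.src g) → g = nineEntry₂ k := by
      decide +kernel
    have hne : ∀ k, nineEntry₁ k ≠ nineEntry₂ k := by decide +kernel
    obtain ⟨β, hβ, hβk⟩ := exists_infix_of_potential h1.1 hmem1 (hpos k).1 (hsrc k) (hent₁ k)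
    obtain ⟨γ, hγ, hγk⟩ := exists_infix_of_potential h2.1 hmem2 (hpos k).2 (hsrc k) (hent₂ k)
    exact ⟨0, 1, by decide, β, hβ, γ, hγ, _, _, hne k, hβk, hγk⟩
  calc (9 : ℕ∞) = ENat.card (Fin 9) := by simp
    _ = (Set.range nineEdge).encard := by
      rw [← Set.image_univ, nineEdge_injective.encard_image, Set.encard_univ]
    _ ≤ _ := Set.encard_le_encard hsub

end Network

theorem mainTheorem9 : MStar ![4, 4] = 9 := by
  refine le_antisymm (sSup_le ?_) (le_sSup_of_le ?_ Network.nine_le_minMergings)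
  · rintro _ ⟨V, E, _, _, G, S, R, hG, -, hcut, rfl⟩
    refine Network.minMergings_le_nine hG fun i => ?_
    fin_cases i
    · exact hcut 0
    · exact hcut 1
  · refine ⟨_, _, inferInstance, inferInstance, nineNet, 0, ![23, 24], Network.nineNet_acyclic,
      by decide, ?_, rfl⟩
    intro i
    fin_cases i
    · exact Network.nineNet_minCut (by decide) Network.ninePaths₁_isDisjointPathSet (by decide)
    · exact Network.nineNet_minCut (by decide) Network.ninePaths₂_isDisjointPathSet (by decide)
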